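/- **Conventions.** An event structure is a set of events with a partial order $\le$ (causal dependency) such that each $\{e' : e'\le e\}$ is finite, and a nonempty family $\mathrm{Con}$ of finite (consistent) sets of events containing all singletons, closed under subsets, and such that $X\in\mathrm{Con}$, $e\le e'\in X$ imply $X\cup\{e\}\in\mathrm{Con}$. A configuration is a (possibly infinite) down-closed set of events all of whose finite subsets are consistent; $s\to s'$ denotes immediate causal dependency. Events carry a polarity: $+$ (Player), $-$ (Opponent) or neutral. A *game* has no neutral events; $A^\perp$ reverses the polarities of $A$; $A\parallel B$ is disjoint juxtaposition; $\boxplus$ is the game with a single Player move, written $\checkmark$. A *map* is a polarity-preserving total function that sends configurations to configurations and is injective on each configuration; it is *rigid* if it preserves $\le$, and *rigid epi* if moreover it is surjective on events and every consistent set of its codomain is the image of a consistent set. Write $x\subseteq^- y$ if $x\subseteq y$ and all events of $y\setminus x$ are Opponent moves. A configuration is *$+$-maximal* if it has no proper extension to a configuration by neutral or Player events only. A *strategy* in a game $A$ is a map $\sigma:S\to A$ which is receptive (if $x,y$ are finite configurations with $\sigma x\subseteq^- y$ there is a unique finite configuration $x'\supseteq x$ with $\sigma x'=y$) and innocent (if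 $s\to s'$ and $s$ is $+$ or $s'$ is $-$, then $\sigma(s)\to\sigma(s')$). A *stopping strategy* $(\sigma,M_S)$ in $A$ is a strategy $\sigma:S\to A$ with a set $M_S$ of configurations of $S$. A *2-cell* $(\sigma,M_S)\Rightarrow(\sigma',M_{S'})$ is a map $h:S\to S'$ with $\sigma' h=\sigma$ and $hx\in M_{S'}$ for all $x\in M_S$. A *test* for $A$ is a receptive and innocent map $\tau:T\to A^\perp\parallel N\parallel\boxplus$, with $N$ consisting of neutral events. Let $T_0$ be the restriction of $T$ to the events not sent to $N$, let $\tau_0:T_0\to A^\perp\parallel\boxplus$ be the restriction of $\tau$, and let $M_0$ be the set of all $z\cap T_0$ with $z$ a $+$-maximal configuration of $T$. For configurations $x$ of $S$ and $y$ of $T_0$ put $\tau_0y=y_A\parallel y_\boxplus$. The interaction $y\circledast x$ is *defined* if $\sigma x=y_A$ and the induced bijection $x\parallel y_\boxplus\cong y$ is secured: the transitive relation on its pairs generated by $(a,b)\le(a',b')$ if $a\le a'$ or $b\le b'$ is a partial order in which each element has only finitely many elements below it. Then $(\sigma,M_S)$ *may pass* $\tau$ if $\checkmark\in\tau_0y$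 for some configurations $x$ of $S$ and $y$ of $T_0$ with $y\circledast x$ defined, and *must pass* $\tau$ if $\checkmark\in\tau_0y$ for all $x\in M_S$, $y\in M_0$ with $y\circledast x$ defined. Two stopping strategies in $A$ are *may* (*must*) *equivalent* if they may (must) pass the same tests. A *rigid image* of a map $\sigma:S\to A$ is a factorisation $\sigma=\sigma_1 f$, with $f:S\to S_1$ rigid epi and $\sigma_1:S_1\to A$ a map, such that for every factorisation $\sigma=g_1g_0$ with $g_0:S\to D$ rigid epi and $g_1:D\to A$ a map there is a unique map $h:D\to S_1$ with $hg_0=f$ and $\sigma_1h=g_1$. The corresponding *rigid image* of $(\sigma,M_S)$ is $(\sigma_1,fM_S)$, where $fM_S=\{fx : x\in M_S\}$. **Proposition.** Let $(\sigma,M_S)$ be a stopping strategy in a game $A$. Then $(\sigma,M_S)$ has a rigid image $(\sigma_1,fM_S)$, and it is unique up to a unique invertible 2-cell commuting with the maps from $S$. The rigid image $(\sigma_1,fM_S)$ is again a stopping strategy in $A$, it is its own rigid image, $f$ is a 2-cell $(\sigma,M_S)\Rightarrow(\sigma_1,fM_S)$, and $(\sigma,M_S)$ is both may and must equivalent to $(\sigma_1,fM_S)$.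 In particular every stopping strategy is may and must equivalent to a rigid-image stopping strategy, i.e. to one which is its own rigid image. -/

import Mathlib

universe u

namespace ConcurrentGames

/-! ### Event structures -/

/-- An event structure on a set `E` of events: a finitary partial order of causal dependency and a
nonempty family `Con` of finite subsets, the consistent ones. -/
structure EventStructure (E : Type u) where
  le : E → E → Prop
  le_refl : ∀ e, le e e
  le_trans : ∀ a b c, le a b → le b c → le a c
  le_antisymm : ∀ a b, le a b → le b a → a = b
  Con : Set (Set E)
  con_finite : ∀ X ∈ Con, X.Finite
  con_nonempty : Con.Nonempty
  finitary : ∀ e, {e' | le e' e}.Finite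
  con_singleton : ∀ e, {e} ∈ Con
  con_subset : ∀ X Y, Y ⊆ X → X ∈ Con → Y ∈ Con
  con_insert : ∀ X e e', X ∈ Con → le e e' → e' ∈ X → insert e X ∈ Con

namespace EventStructure

variable {E : Type u} (S : EventStructure E)

/-- Possibly infinite configurations: consistent and down-closed sets of events. -/
def IsConfig (x : Set E) : Prop :=
  (∀ X, X ⊆ x → X.Finite → X ∈ S.Con) ∧ ∀ e e', S.le e' e → e ∈ x → e' ∈ x

/-- Finite configurations. -/
def IsFinConfig (x : Set E) : Prop :=
  S.IsConfig x ∧ x.Finite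

/-- Immediate causal dependency. -/
def Imm (e e' : E) : Prop :=
  e ≠ e' ∧ S.le e e' ∧ ∀ d, S.le e d → S.le d e' → d = e ∨ d = e'

end EventStructure

/-! ### Polarity -/

/-- Player (`pos`), Opponent (`neg`) and neutral moves. -/
inductive Polarity where
  | pos
  | neg
  | neutral

/-- Exchange the roles of Player and Opponent. -/
def Polarity.dual : Polarity → Polarity
  | pos => neg
  | neg => pos
  | neutral => neutral

/-- Event structures with polarity. -/
structure PolES (E : Type u) extends EventStructure E where
  pol : E → Polarity

namespace PolES

variable {E F : Type u}

/-- A game is an event structure with polarity without neutral moves. -/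
def IsGame (A : PolES E) : Prop :=
  ∀ a, A.pol a ≠ Polarity.neutral

/-- An event structure consisting solely of neutral events. -/
def AllNeutral (A : PolES E) : Prop :=
  ∀ a, A.pol a = Polarity.neutral

/-- `x ⊆⁻ y`: an inclusion in which all intervening events are moves of Opponent. -/
def SubNeg (A : PolES E) (x y : Set E) : Prop :=
  x ⊆ y ∧ ∀ e ∈ y \ x, A.pol e = Polarity.neg

/-- `x ⊆⁺ y`: an inclusion in which all intervening events are neutral or moves of Player. -/
def SubPos (A : PolES E) (x y : Set E) : Prop :=
  x ⊆ y ∧ ∀ e ∈ y \ x, A.pol e = Polarity.pos ∨ A.pol e = Polarity.neutral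

/-- `+`-maximal configurations. -/
def IsPosMaximal (A : PolES E) (x : Set E) : Prop :=
  A.IsConfig x ∧ ∀ y, A.IsConfig y → A.SubPos x y → y = x

/-- The dual `A^⊥`. -/
def dual (A : PolES E) : PolES E where
  toEventStructure := A.toEventStructure
  pol e := (A.pol e).dual

/-- Simple parallel composition `A ∥ B`. -/
def par (A : PolES E) (B : PolES F) : PolES (E ⊕ F) where
  le := Sum.LiftRel A.le B.le
  le_refl e := by
    cases e
    · exact .inl (A.le_refl _)
    · exact .inr (B.le_refl _)
  le_trans a b c h₁ h₂ := by
    cases h₁ <;> cases h₂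
    · exact .inl (A.le_trans _ _ _ ‹_› ‹_›)
    · exact .inr (B.le_trans _ _ _ ‹_› ‹_›)
  le_antisymm a b h₁ h₂ := by
    cases h₁ <;> cases h₂
    · exact congrArg _ (A.le_antisymm _ _ ‹_› ‹_›)
    · exact congrArg _ (B.le_antisymm _ _ ‹_› ‹_›)
  Con := {X | Sum.inl ⁻¹' X ∈ A.Con ∧ Sum.inr ⁻¹' X ∈ B.Con}
  con_finite X h := by
    refine (((A.con_finite _ h.1).image Sum.inl).union
      ((B.con_finite _ h.2).image Sum.inr)).subset ?_
    rintro (e | e) he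
    · exact Or.inl ⟨e, he, rfl⟩
    · exact Or.inr ⟨e, he, rfl⟩
  con_nonempty := by
    obtain ⟨X, hX⟩ := A.con_nonempty
    obtain ⟨Y, hY⟩ := B.con_nonempty
    refine ⟨∅, A.con_subset X _ ?_ hX, B.con_subset Y _ ?_ hY⟩ <;> simp
  finitary e := by
    rcases e with e | e
    · refine ((A.finitary e).image Sum.inl).subset ?_
      intro e' h
      cases h with
      | inl h => exact ⟨_, h, rfl⟩
    · refine ((B.finitary e).image Sum.inr).subset ?_
      intro e' h
      cases h with
      | inr h => exact ⟨_, h, rfl⟩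
  con_singleton e := by
    rcases e with e | e
    · exact ⟨A.con_subset _ _ (fun a ha => by simpa using ha) (A.con_singleton e),
        by
          obtain ⟨Y, hY⟩ := B.con_nonempty
          exact B.con_subset Y _ (fun a ha => by simp at ha) hY⟩
    · exact ⟨by
          obtain ⟨Y, hY⟩ := A.con_nonempty
          exact A.con_subset Y _ (fun a ha => by simp at ha) hY,
        B.con_subset _ _ (fun a ha => by simpa using ha) (B.con_singleton e)⟩
  con_subset X Y h hX :=
    ⟨A.con_subset _ _ (Set.preimage_mono h) hX.1, B.con_subset _ _ (Set.preimage_mono h) hX.2⟩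
  con_insert X e e' hX h he' := by
    cases h with
    | inl h =>
      exact ⟨A.con_subset _ _ (fun a ha => by simpa using ha) (A.con_insert _ _ _ hX.1 h he'),
        B.con_subset _ _ (fun a ha => by simpa using ha) hX.2⟩
    | inr h =>
      exact ⟨A.con_subset _ _ (fun a ha => by simpa using ha) hX.1,
        B.con_subset _ _ (fun a ha => by simpa using ha) (B.con_insert _ _ _ hX.2 h he')⟩
  pol := Sum.elim A.pol B.pol

/-- The projection `S ↓ V` of an event structure to a set `V` of visible events. -/
def restrict (S : PolES E) (V : Set E) : PolES V where
  le a b := S.le a b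
  le_refl a := S.le_refl a
  le_trans a b c := S.le_trans a b c
  le_antisymm a b h₁ h₂ := Subtype.ext (S.le_antisymm a b h₁ h₂)
  Con := {X | Subtype.val '' X ∈ S.Con}
  con_finite X h := (S.con_finite _ h).of_finite_image Subtype.val_injective.injOn
  con_nonempty := by
    obtain ⟨X, hX⟩ := S.con_nonempty
    exact ⟨∅, S.con_subset X _ (by simp) hX⟩
  finitary a := (S.finitary a).preimage Subtype.val_injective.injOn
  con_singleton a := by
    simpa using S.con_singleton a
  con_subset X Y h hX := S.con_subset _ _ (Set.image_mono h) hX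
  con_insert X a b hX h hb := by
    simpa [Set.image_insert_eq] using S.con_insert _ _ _ hX h (Set.mem_image_of_mem _ hb)
  pol a := S.pol a

/-- The game `⊞` consisting of a single Player move. -/
def tick : PolES PUnit.{u + 1} where
  le _ _ := True
  le_refl _ := trivial
  le_trans _ _ _ _ _ := trivial
  le_antisymm _ _ _ _ := rfl
  Con := Set.univ
  con_finite X _ := X.toFinite
  con_nonempty := ⟨∅, trivial⟩
  finitary _ := Set.toFinite _
  con_singleton _ := trivial
  con_subset _ _ _ _ := trivial
  con_insert _ _ _ _ _ _ := trivial
  pol _ := Polarity.pos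

end PolES

/-! ### Total maps, rigid maps, rigid images -/

section Maps

variable {E F : Type u}

/-- Total maps of event structures with polarity: they send configurations to configurations, are
injective on each configuration, and preserve polarity. -/
def IsMap (S : PolES E) (S' : PolES F) (f : E → F) : Prop :=
  (∀ x, S.IsConfig x → S'.IsConfig (f '' x) ∧ Set.InjOn f x) ∧ ∀ e, S'.pol (f e) = S.pol e

/-- Rigid maps: total maps which preserve causal dependency. -/
def IsRigid (S : PolES E) (S' : PolES F) (f : E → F) : Prop :=
  IsMap S S' f ∧ ∀ a b, S.le a b → S'.le (f a) (f b)

/-- Rigid epis: rigid maps onto, in that all the events of the codomain are images of events, and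
its consistent sets are images of consistent sets. -/
def IsRigidEpi (S : PolES E) (S' : PolES F) (f : E → F) : Prop :=
  IsRigid S S' f ∧ Function.Surjective f ∧ ∀ Y ∈ S'.Con, ∃ X ∈ S.Con, f '' X = Y

/-- `f = f₁ ∘ f₀`, through `S₀`, is the rigid image factorisation of the total map `f : S → B`:
`f₀` is rigid epi, `f₁` is total, and every factorisation `f = g₁ ∘ g₀` with `g₀` rigid epi and
`g₁` total maps to it by a unique map. -/
def IsRigidImageFactorisation {E₀ : Type u} (S : PolES E) (B : PolES F) (f : E → F)
    (S₀ : PolES E₀) (f₀ : E → E₀) (f₁ : E₀ → F) : Prop :=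
  IsRigidEpi S S₀ f₀ ∧ IsMap S₀ B f₁ ∧ f₁ ∘ f₀ = f ∧
    ∀ (D : Type u) (R : PolES D) (g₀ : E → D) (g₁ : D → F),
      IsRigidEpi S R g₀ → IsMap R B g₁ → g₁ ∘ g₀ = f →
        ∃! h : D → E₀, IsMap R S₀ h ∧ h ∘ g₀ = f₀ ∧ f₁ ∘ h = g₁

end Maps

/-! ### Strategies -/

section Strategies

variable {E F : Type u}

/-- Receptivity. -/
def IsReceptive (S : PolES E) (A : PolES F) (σ : E → F) : Prop :=
  ∀ x y, S.IsFinConfig x → A.IsFinConfig y → A.SubNeg (σ '' x) y →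
    ∃! x', S.IsFinConfig x' ∧ x ⊆ x' ∧ σ '' x' = y

/-- Innocence, the conjunction of `+`-innocence and `-`-innocence. -/
def IsInnocent (S : PolES E) (A : PolES F) (σ : E → F) : Prop :=
  (∀ s s', S.Imm s s' → S.pol s = Polarity.pos → A.Imm (σ s) (σ s')) ∧
    ∀ s s', S.Imm s s' → S.pol s' = Polarity.neg → A.Imm (σ s) (σ s')

/-- Bare strategies `σ : S → A^⊥ ∥ N ∥ B` from a game `A` to a game `B`. -/
def IsBareStrategy {X N Y : Type u} (A : PolES X) (M : PolES N) (B : PolES Y)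
    (S : PolES E) (σ : E → X ⊕ (N ⊕ Y)) : Prop :=
  M.AllNeutral ∧ IsMap S (A.dual.par (M.par B)) σ ∧
    IsReceptive S (A.dual.par (M.par B)) σ ∧ IsInnocent S (A.dual.par (M.par B)) σ

/-- Strategies `σ : S → A` in a game `A`. -/
def IsStrategy (A : PolES F) (S : PolES E) (σ : E → F) : Prop :=
  IsMap S A σ ∧ IsReceptive S A σ ∧ IsInnocent S A σ

end Strategies

/-! ### The visible part of a bare strategy and its stopping configurations -/

section Visible

variable {E X N Y : Type u}

/-- The partial projection `X ∥ N ∥ Y → X ∥ Y`. -/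
def hide : X ⊕ (N ⊕ Y) → Option (X ⊕ Y)
  | .inl a => some (.inl a)
  | .inr (.inl _) => none
  | .inr (.inr b) => some (.inr b)

/-- The events at which the composite of `σ` with the projection is defined. -/
def visible (σ : E → X ⊕ (N ⊕ Y)) : Set E :=
  {s | (hide (σ s)).isSome}

/-- The defined part `σ_↓ : S ↓ visible σ → X ∥ Y`. -/
def visMap (σ : E → X ⊕ (N ⊕ Y)) (s : visible σ) : X ⊕ Y :=
  (hide (σ s)).get s.2

/-- `Stop(σ)`: the visible images of the `+`-maximal configurations. -/
def Stop (S : PolES E) (σ : E → X ⊕ (N ⊕ Y)) : Set (Set (visible σ)) :=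
  {y | ∃ x, S.IsPosMaximal x ∧ y = Subtype.val ⁻¹' x}

end Visible

/-! ### Secured bijections and interaction -/

section Interaction

variable {E F C : Type u}

/-- The relation `θ` between `x` and `y` over their common image. -/
def pairing (f : E → C) (g : F → C) (x : Set E) (y : Set F) : Set (E × F) :=
  {p | p.1 ∈ x ∧ p.2 ∈ y ∧ f p.1 = g p.2}

/-- The transitive relation on `θ` generated by `(a, b) ≤ (a', b')` if `a ≤ a'` or `b ≤ b'`. -/
def pairLE (S : PolES E) (T : PolES F) (θ : Set (E × F)) : E × F → E × F → Prop :=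
  Relation.TransGen fun p q => p ∈ θ ∧ q ∈ θ ∧ (S.le p.1 q.1 ∨ T.le p.2 q.2)

/-- For total maps `f : S → C` and `g : T → C`, the configurations `x` of `S` and `y` of `T` form a
secured bijection `x ≅ f x = g y ≅ y`. This is the condition for the configuration `x ∧ y` of the
pullback of `f` and `g` to be defined. -/
def IsSecuredBijection (S : PolES E) (T : PolES F) (f : E → C) (g : F → C)
    (x : Set E) (y : Set F) : Prop :=
  S.IsConfig x ∧ T.IsConfig y ∧ f '' x = g '' y ∧
    (∀ p q, pairLE S T (pairing f g x y) p q → pairLE S T (pairing f g x y) q p → p = q) ∧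
    ∀ p, {q | pairLE S T (pairing f g x y) q p}.Finite

/-- For `σ : S → A` and `τ : T → A^⊥ ∥ C`, the configuration `y ⊛ x = (x ∥ y_C) ∧ y` of the
pullback of `σ ∥ C : S ∥ C → A ∥ C` and `τ : T → A ∥ C` is defined. Here `y_C` is the component of
`τ y` in `C`. -/
def InteractionDefined {X Y : Type u} (C : PolES Y) (S : PolES E) (σ : E → X)
    (T : PolES F) (τ : F → X ⊕ Y) (x : Set E) (y : Set F) : Prop :=
  IsSecuredBijection (S.par C) T (Sum.map σ id) τ
    (Sum.inl '' x ∪ Sum.inr '' (Sum.inr ⁻¹' (τ '' y))) y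

end Interaction

/-! ### Stopping strategies and testing -/

/-- A map `σ : S → A` together with a set of sets of events of `S`. -/
structure MarkedMap {X : Type u} (A : PolES X) where
  Ev : Type u
  es : PolES Ev
  map : Ev → X
  stops : Set (Set Ev)

namespace MarkedMap

variable {X : Type u} {A : PolES X}

/-- `(σ, M_S)` is a stopping strategy in `A`: `σ` is a strategy in `A` and `M_S` consists of
configurations of `S`. -/
def IsStoppingStrategy (P : MarkedMap A) : Prop :=
  IsStrategy A P.es P.map ∧ ∀ x ∈ P.stops, P.es.IsConfig x

/-- `h` is a 2-cell `P ⇒ Q`. -/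
def IsTwoCell (P Q : MarkedMap A) (h : P.Ev → Q.Ev) : Prop :=
  IsMap P.es Q.es h ∧ Q.map ∘ h = P.map ∧ ∀ x ∈ P.stops, h '' x ∈ Q.stops

/-- `P` may pass the test `τ : T → A^⊥ ∥ N ∥ ⊞`. -/
def MayPass (P : MarkedMap A) {N F : Type u} (T : PolES F)
    (τ : F → X ⊕ (N ⊕ PUnit.{u + 1})) : Prop :=
  ∃ (x : Set P.Ev) (y : Set (visible τ)), P.es.IsConfig x ∧ (T.restrict (visible τ)).IsConfig y ∧
    InteractionDefined PolES.tick P.es P.map (T.restrict (visible τ)) (visMap τ) x y ∧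
    Sum.inr PUnit.unit ∈ visMap τ '' y

/-- `P` must pass the test `τ : T → A^⊥ ∥ N ∥ ⊞`. -/
def MustPass (P : MarkedMap A) {N F : Type u} (T : PolES F)
    (τ : F → X ⊕ (N ⊕ PUnit.{u + 1})) : Prop :=
  ∀ (x : Set P.Ev) (y : Set (visible τ)), x ∈ P.stops → y ∈ Stop T τ →
    InteractionDefined PolES.tick P.es P.map (T.restrict (visible τ)) (visMap τ) x y →
    Sum.inr PUnit.unit ∈ visMap τ '' y

/-- `P` and `Q` may pass the same tests; a test is a bare strategy from `A` to `⊞`. -/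
def MayEquiv (P Q : MarkedMap A) : Prop :=
  ∀ (N F : Type u) (M : PolES N) (T : PolES F) (τ : F → X ⊕ (N ⊕ PUnit.{u + 1})),
    IsBareStrategy A M PolES.tick T τ → (P.MayPass T τ ↔ Q.MayPass T τ)

/-- `P` and `Q` must pass the same tests; a test is a bare strategy from `A` to `⊞`. -/
def MustEquiv (P Q : MarkedMap A) : Prop :=
  ∀ (N F : Type u) (M : PolES N) (T : PolES F) (τ : F → X ⊕ (N ⊕ PUnit.{u + 1})),
    IsBareStrategy A M PolES.tick T τ → (P.MustPass T τ ↔ Q.MustPass T τ)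

/-- `Q = (σ₁, f M_S)` is the rigid image of `P = (σ, M_S)`, where `σ = σ₁ ∘ f` is the rigid image
factorisation of `σ`. -/
def IsRigidImage (P Q : MarkedMap A) (f : P.Ev → Q.Ev) : Prop :=
  IsRigidImageFactorisation P.es A P.map Q.es f Q.map ∧ Q.stops = (fun x => f '' x) '' P.stops

/-- A rigid-image stopping strategy: a stopping strategy which is its own rigid image. -/
def IsRigidImageStoppingStrategy (P : MarkedMap A) : Prop :=
  P.IsStoppingStrategy ∧ P.IsRigidImage P id

end MarkedMap

end ConcurrentGames

open ConcurrentGames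

/-!
The rigid image of a total map `σ : S → A` is obtained by identifying two events `s`, `s'` whose
down-closures are isomorphic over `A`. As `σ` is injective on the configuration `{e | e ≤ s}`, such
an isomorphism amounts to the equality of the *histories* of `s` and `s'`: the history of `s` records
`σ s` and the image under `σ` of the causal order below `s`. Histories are unchanged by rigid maps
over `A` (`history_comp`), so they descend along every rigid epi, and a factorisation
`σ = f₁ ∘ f` with `f : S → S₀` rigid epi is a rigid image exactly when the history of `f₁` separates
the events of `S₀` (`isRigidImageFactorisation_of_injective_history`, `injective_history`).

A rigid epi restricts to order isomorphisms on configurations, and every finite configuration of its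
codomain is the image of a finite configuration. Innocence of the rigid image, and the existence
half of receptivity, are inherited from `σ` through these lifts. For the uniqueness half, innocence
shows that the causal order below an added Opponent move is determined by that of `A`; two extensions
with the same image thus have the same histories (`eq_of_isInnocent`), hence the same events.

Whether the interaction `y ⊛ x` is defined depends on `x` only through its causal order over `A`, so
it agrees with whether `y ⊛ f x` is defined (`interactionDefined_image_iff`). This gives must
equivalence at once. For may equivalence an infinite configuration of the rigid image need not lift;
but the pairs below a successful move form a finite secured bijection
(`IsSecuredBijection.exists_finite`), whose left side does lift.
-/

namespace ConcurrentGames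

/-! ### Configurations and the causal order -/

namespace EventStructure

variable {E : Type u} (S : EventStructure E)

/-- The finite set of events causally below `e`, written `[e]`. -/
def below (e : E) : Set E := {e' | S.le e' e}

/-- The set of events causally below some event of `X`. -/
def downClosure (X : Set E) : Set E := {e | ∃ e' ∈ X, S.le e e'}

theorem subset_downClosure (X : Set E) : X ⊆ S.downClosure X :=
  fun e he => ⟨e, he, S.le_refl e⟩

theorem isFinConfig_downClosure {X : Set E} (hX : X ∈ S.Con) :
    S.IsFinConfig (S.downClosure X) := by
  refine ⟨⟨fun Y hY hfin => ?_, ?_⟩, ?_⟩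
  · have key : ∀ Z : Set E, Z.Finite → Z ⊆ S.downClosure X → Z ∪ X ∈ S.Con := by
      intro Z hZ
      induction Z, hZ using Set.Finite.induction_on with
      | empty => intro _; simpa using hX
      | @insert a Z _ _ ih =>
        intro h
        obtain ⟨e', he', hle⟩ := h (Set.mem_insert a Z)
        rw [Set.insert_union]
        exact S.con_insert _ a e' (ih fun z hz => h (Set.mem_insert_of_mem _ hz)) hle (Or.inr he')
    exact S.con_subset _ _ Set.subset_union_left (key Y hfin hY)
  · rintro e e' hle ⟨d, hd, hed⟩
    exact ⟨d, hd, S.le_trans _ _ _ hle hed⟩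
  · have h : S.downClosure X = ⋃ e ∈ X, S.below e := by
      ext e; simp [downClosure, below]
    rw [h]
    exact (S.con_finite _ hX).biUnion fun e _ => S.finitary e

theorem isConfig_below (e : E) : S.IsConfig (S.below e) := by
  have h : S.below e = S.downClosure {e} := by ext; simp [below, downClosure]
  rw [h]
  exact (S.isFinConfig_downClosure (S.con_singleton e)).1

theorem mem_below_self (e : E) : e ∈ S.below e := S.le_refl e

variable {S}

theorem IsFinConfig.mem_con {x : Set E} (hx : S.IsFinConfig x) : x ∈ S.Con :=
  hx.1.1 x subset_rfl hx.2

theorem ncard_below_lt {a b : E} (hab : S.le a b) (hne : a ≠ b) :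
    (S.below a).ncard < (S.below b).ncard := by
  refine Set.ncard_lt_ncard ⟨fun d hd => S.le_trans _ _ _ hd hab, fun h => hne ?_⟩ (S.finitary b)
  exact S.le_antisymm _ _ hab (h (S.le_refl b))

/-- Causal dependency is well founded: events may be reasoned about by induction on their
down-closures. -/
theorem causal_induction {p : E → Prop}
    (h : ∀ e, (∀ d, S.le d e → d ≠ e → p d) → p e) (e : E) : p e := by
  induction hn : (S.below e).ncard using Nat.strong_induction_on generalizing e with
  | _ n ih =>
    exact h e fun d hd hne => ih _ (hn ▸ ncard_below_lt hd hne) d rfl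

theorem exists_imm {a b : E} (hab : S.le a b) (hne : a ≠ b) : ∃ d, S.le a d ∧ S.Imm d b := by
  obtain ⟨d, ⟨had, hdb, hd⟩, hmax⟩ := Set.exists_max_image
    {d | S.le a d ∧ S.le d b ∧ d ≠ b} (fun d => (S.below d).ncard)
    ((S.finitary b).subset fun d hd => hd.2.1) ⟨a, S.le_refl a, hab, hne⟩
  refine ⟨d, had, hd, hdb, fun c hdc hcb => ?_⟩
  by_contra! hc
  exact (ncard_below_lt hdc hc.1.symm).not_ge
    (hmax c ⟨S.le_trans _ _ _ had hdc, hcb, hc.2⟩)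

end EventStructure

open EventStructure

/-! ### Total maps and rigid epis -/

section Maps

variable {E F G : Type u} {S : PolES E} {R : PolES F} {B : PolES G}

theorem IsMap.id (S : PolES E) : IsMap S S id :=
  ⟨fun x hx => ⟨by simpa using hx, Set.injOn_id x⟩, fun _ => rfl⟩

theorem IsMap.comp {g : F → G} {f : E → F} (hg : IsMap R B g) (hf : IsMap S R f) :
    IsMap S B (g ∘ f) := by
  refine ⟨fun x hx => ?_, fun e => (hg.2 _).trans (hf.2 e)⟩
  obtain ⟨hfx, hinj⟩ := hf.1 x hx
  obtain ⟨hgx, hginj⟩ := hg.1 _ hfx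
  exact ⟨by rwa [Set.image_comp], hginj.comp hinj (Set.mapsTo_image f x)⟩

/-- A map sends the down-closure of an event onto a down-closed set, so that causes lift. -/
theorem IsMap.exists_le {f : E → F} (hf : IsMap S R f) {c : F} {e : E} (h : R.le c (f e)) :
    ∃ a, S.le a e ∧ f a = c :=
  (hf.1 _ (S.isConfig_below e)).1.2 (f e) c h ⟨e, S.mem_below_self e, rfl⟩

theorem IsMap.eq_of_le {f : E → F} (hf : IsMap S R f) {a b e : E} (ha : S.le a e) (hb : S.le b e)
    (h : f a = f b) : a = b :=
  (hf.1 _ (S.isConfig_below e)).2 ha hb h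

/-- Maps reflect causal dependency within a configuration. -/
theorem IsMap.le_of_le {f : E → F} (hf : IsMap S R f) {x : Set E} (hx : S.IsConfig x) {a b : E}
    (ha : a ∈ x) (hb : b ∈ x) (h : R.le (f a) (f b)) : S.le a b := by
  obtain ⟨a', ha', he⟩ := hf.exists_le h
  rwa [← (hf.1 x hx).2 (hx.2 _ _ ha' hb) ha he]

theorem IsMap.image_con {f : E → F} (hf : IsMap S R f) {X : Set E} (hX : X ∈ S.Con) :
    f '' X ∈ R.Con :=
  (hf.1 _ (S.isFinConfig_downClosure hX).1).1.1 _ (Set.image_mono (S.subset_downClosure X))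
    ((S.con_finite _ hX).image f)

theorem IsRigidEpi.id (S : PolES E) : IsRigidEpi S S id :=
  ⟨⟨IsMap.id S, fun _ _ h => h⟩, Function.surjective_id, fun Y hY => ⟨Y, hY, by simp⟩⟩

/-- A function is a map as soon as its composite with a rigid epi is. -/
theorem IsRigidEpi.isMap_of_comp {f : E → F} (hf : IsRigidEpi S R f) {h : F → G}
    (hh : IsMap S B (h ∘ f)) : IsMap R B h := by
  refine ⟨fun z hz => ⟨⟨?_, ?_⟩, ?_⟩, fun d => ?_⟩
  · intro Y hY hfin
    obtain ⟨Z, hZz, hZfin, rfl⟩ := (Set.exists_subset_image_finite_and (p := fun W => W = Y)).1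
      ⟨Y, hY, hfin, rfl⟩
    obtain ⟨X, hX, rfl⟩ := hf.2.2 Z (hz.1 Z hZz hZfin)
    rw [← Set.image_comp]
    exact hh.image_con hX
  · rintro _ c hle ⟨d, hd, rfl⟩
    obtain ⟨s, rfl⟩ := hf.2.1 d
    obtain ⟨a, ha, rfl⟩ := hh.exists_le hle
    exact ⟨f a, hz.2 _ _ (hf.1.2 _ _ ha) hd, rfl⟩
  · intro d hd d' hd' he
    have hsub : {d, d'} ⊆ z := Set.insert_subset hd (Set.singleton_subset_iff.2 hd')
    obtain ⟨X, hX, hXe⟩ := hf.2.2 _ (hz.1 _ hsub (Set.toFinite _))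
    obtain ⟨a, ha, rfl⟩ : d ∈ f '' X := by rw [hXe]; simp
    obtain ⟨b, hb, rfl⟩ : d' ∈ f '' X := by rw [hXe]; simp
    have hcfg := (S.isFinConfig_downClosure hX).1
    rw [(hh.1 _ hcfg).2 (S.subset_downClosure X ha) (S.subset_downClosure X hb) he]
  · obtain ⟨s, rfl⟩ := hf.2.1 d
    exact (hh.2 s).trans (hf.1.1.2 s).symm

theorem IsRigidEpi.exists_isFinConfig {f : E → F} (hf : IsRigidEpi S R f) {z : Set F}
    (hz : R.IsFinConfig z) : ∃ x, S.IsFinConfig x ∧ f '' x = z := by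
  obtain ⟨X, hX, rfl⟩ := hf.2.2 z hz.mem_con
  refine ⟨_, S.isFinConfig_downClosure hX, Set.Subset.antisymm ?_
    (Set.image_mono (S.subset_downClosure X))⟩
  rintro _ ⟨e, ⟨e', he', hle⟩, rfl⟩
  exact hz.1.2 _ _ (hf.1.2 _ _ hle) ⟨e', he', rfl⟩

end Maps

/-! ### Histories -/

section History

variable {E F X : Type u} {S : PolES E} {R : PolES F} {A : PolES X}

/-- The history of `e`: its image under `σ`, together with the image under `σ` of the causal order
on the events below `e`. For a total map `σ`, two events have equal histories if and only if their
down-closures are isomorphic over the codomain of `σ`. -/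
def history (S : PolES E) (σ : E → X) (e : E) : X × Set (X × X) :=
  (σ e, {p | ∃ a b, S.le a b ∧ S.le b e ∧ p = (σ a, σ b)})

theorem history_comp {g₀ : E → F} (hg₀ : IsRigid S R g₀) (g₁ : F → X) (s : E) :
    history R g₁ (g₀ s) = history S (g₁ ∘ g₀) s := by
  refine Prod.ext rfl (Set.Subset.antisymm ?_ ?_)
  · rintro _ ⟨c, d, hcd, hd, rfl⟩
    obtain ⟨b, hb, rfl⟩ := hg₀.1.exists_le hd
    obtain ⟨a, ha, rfl⟩ := hg₀.1.exists_le hcd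
    exact ⟨a, b, ha, hb, rfl⟩
  · rintro _ ⟨a, b, hab, hb, rfl⟩
    exact ⟨_, _, hg₀.2 _ _ hab, hg₀.2 _ _ hb, rfl⟩

theorem mem_history_snd_iff_of_le {σ : E → X} (hσ : IsMap S A σ) {a b : E} (hab : S.le a b)
    (p : X × X) : p ∈ (history S σ a).2 ↔
      p ∈ (history S σ b).2 ∧ (p.2, σ a) ∈ (history S σ b).2 := by
  constructor
  · rintro ⟨u, v, huv, hva, rfl⟩
    exact ⟨⟨u, v, huv, S.le_trans _ _ _ hva hab, rfl⟩, ⟨v, a, hva, hab, rfl⟩⟩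
  · rintro ⟨⟨u, v, huv, hvb, rfl⟩, ⟨v', a', hva, hab', h⟩⟩
    obtain ⟨h₁, h₂⟩ := Prod.mk.inj h
    obtain rfl := hσ.eq_of_le hvb (S.le_trans _ _ _ hva hab') h₁
    obtain rfl := hσ.eq_of_le hab hab' h₂
    exact ⟨u, v, huv, hva, rfl⟩

/-- Causes lift along equality of histories. -/
theorem exists_le_history_eq {σ : E → X} (hσ : IsMap S A σ) {a' b' b : E} (hab : S.le a' b')
    (h : history S σ b' = history S σ b) : ∃ a, S.le a b ∧ history S σ a = history S σ a' := by
  have h₁ : σ b' = σ b := congrArg Prod.fst h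
  have h₂ : (σ a', σ b') ∈ (history S σ b).2 := h ▸ ⟨a', b', hab, S.le_refl _, rfl⟩
  obtain ⟨a, d, had, hdb, he⟩ := h₂
  obtain ⟨ha, hd⟩ := Prod.mk.inj he
  obtain rfl := hσ.eq_of_le hdb (S.le_refl b) (hd.symm.trans h₁)
  refine ⟨a, had, Prod.ext ha.symm ?_⟩
  ext p
  rw [mem_history_snd_iff_of_le hσ had, mem_history_snd_iff_of_le hσ hab, h, ha]

theorem history_snd_subset {σ : E → X} {c c' : E} (hc : σ c = σ c')
    (h : ∀ u, S.le u c → u ≠ c → S.le u c') : (history S σ c).2 ⊆ (history S σ c').2 := by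
  rintro _ ⟨u, v, huv, hvc, rfl⟩
  by_cases hv : v = c
  · subst hv
    by_cases hu : u = v
    · subst hu
      exact ⟨c', c', S.le_refl _, S.le_refl _, by rw [hc]⟩
    · exact ⟨u, c', h u huv hu, S.le_refl _, by rw [hc]⟩
  · exact ⟨u, v, huv, h v hvc hv, rfl⟩

end History

/-! ### The rigid image -/

section RigidImage

variable {E F X : Type u} {S : PolES E} {A : PolES X}

/-- The event structure induced along a surjection `f` which is injective on down-closures and along
whose fibres causes lift: causal dependency and consistency are the direct images under `f`. -/
def PolES.quotient (S : PolES E) (f : E → F) (hf : Function.Surjective f)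
    (hinj : ∀ a b, S.le a b → f a = f b → a = b)
    (hlift : ∀ a' b' b, S.le a' b' → f b' = f b → ∃ a, S.le a b ∧ f a = f a')
    (pol : F → Polarity) : PolES F where
  le c d := ∃ a b, S.le a b ∧ f a = c ∧ f b = d
  le_refl c := by
    obtain ⟨a, rfl⟩ := hf c
    exact ⟨a, a, S.le_refl a, rfl, rfl⟩
  le_trans := by
    rintro _ _ _ ⟨a, b', hab, rfl, rfl⟩ ⟨b, c, hbc, hb, rfl⟩
    obtain ⟨a₂, ha₂, he⟩ := hlift a b' b hab hb.symm
    exact ⟨a₂, c, S.le_trans _ _ _ ha₂ hbc, he, rfl⟩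
  le_antisymm := by
    rintro _ _ ⟨a, b, hab, rfl, rfl⟩ ⟨b', a', hba, hb, ha⟩
    obtain ⟨b₂, hb₂, he⟩ := hlift b' a' a hba ha
    obtain rfl := hinj b₂ b (S.le_trans _ _ _ hb₂ hab) (he.trans hb)
    rw [S.le_antisymm _ _ hab hb₂]
  Con := {Y | ∃ X ∈ S.Con, f '' X = Y}
  con_finite := by
    rintro _ ⟨X, hX, rfl⟩
    exact (S.con_finite X hX).image f
  con_nonempty := by
    obtain ⟨X, hX⟩ := S.con_nonempty
    exact ⟨_, X, hX, rfl⟩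
  finitary d := by
    obtain ⟨b, rfl⟩ := hf d
    refine ((S.finitary b).image f).subset ?_
    rintro _ ⟨a', b', hab, rfl, hb⟩
    obtain ⟨a, ha, he⟩ := hlift a' b' b hab hb
    exact ⟨a, ha, he⟩
  con_singleton d := by
    obtain ⟨b, rfl⟩ := hf d
    exact ⟨{b}, S.con_singleton b, by simp⟩
  con_subset := by
    rintro _ Y hY ⟨X, hX, rfl⟩
    obtain ⟨Z, hZ, rfl⟩ := Set.subset_image_iff.1 hY
    exact ⟨Z, S.con_subset _ _ hZ hX, rfl⟩
  con_insert := by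
    rintro _ _ _ ⟨X, hX, rfl⟩ ⟨a', b', hab, rfl, hb'⟩ ⟨b, hb, rfl⟩
    obtain ⟨a, ha, he⟩ := hlift a' b' b hab hb'
    exact ⟨insert a X, S.con_insert X a b hX ha hb, by rw [Set.image_insert_eq, he]⟩
  pol := pol

/-- The rigid image of `σ : S → A`: its events are the histories of events of `S`. -/
def rigidImage {σ : E → X} (hσ : IsMap S A σ) : PolES (Set.range (history S σ)) :=
  S.quotient (Set.rangeFactorization (history S σ)) Set.rangeFactorization_surjective
    (fun a b hab h => hσ.eq_of_le hab (S.le_refl b)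
      (congrArg Prod.fst (congrArg Subtype.val h)))
    (fun a' b' b hab h => by
      obtain ⟨a, ha, he⟩ := exists_le_history_eq hσ hab
        (congrArg Subtype.val h)
      exact ⟨a, ha, Subtype.ext he⟩)
    (fun c => A.pol c.1.1)

theorem isRigidEpi_rigidImage {σ : E → X} (hσ : IsMap S A σ) :
    IsRigidEpi S (rigidImage hσ) (Set.rangeFactorization (history S σ)) := by
  refine ⟨⟨⟨fun x hx => ⟨⟨?_, ?_⟩, ?_⟩, fun e => hσ.2 e⟩, ?_⟩,
    Set.rangeFactorization_surjective, fun Y hY => hY⟩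
  · intro Y hY hfin
    obtain ⟨Z, hZx, hZfin, rfl⟩ := (Set.exists_subset_image_finite_and (p := fun W => W = Y)).1
      ⟨Y, hY, hfin, rfl⟩
    exact ⟨Z, hx.1 Z hZx hZfin, rfl⟩
  · rintro _ _ ⟨a', b', hab, rfl, hb⟩ ⟨b, hbx, rfl⟩
    obtain ⟨a, ha, he⟩ := exists_le_history_eq hσ hab (congrArg Subtype.val hb)
    exact ⟨a, hx.2 _ _ ha hbx, Subtype.ext he⟩
  · intro a ha b hb h
    exact (hσ.1 x hx).2 ha hb (congrArg (fun c => c.1.1) h)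
  · intro a b hab
    exact ⟨a, b, hab, rfl, rfl⟩

theorem isMap_rigidImage {σ : E → X} (hσ : IsMap S A σ) :
    IsMap (rigidImage hσ) A (fun c => c.1.1) :=
  (isRigidEpi_rigidImage hσ).isMap_of_comp hσ

variable {S₀ : PolES F} {σ : E → X} {f : E → F} {f₁ : F → X}

theorem isRigidImageFactorisation_of_injective_history (hf : IsRigidEpi S S₀ f)
    (hf₁ : IsMap S₀ A f₁) (hσ : f₁ ∘ f = σ) (hinj : Function.Injective (history S₀ f₁)) :
    IsRigidImageFactorisation S A σ S₀ f f₁ := by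
  refine ⟨hf, hf₁, hσ, fun D R g₀ g₁ hg₀ hg₁ hg => ?_⟩
  -- Events identified by `g₀` have the same history, hence are identified by `f`.
  have hwd : ∀ s s', g₀ s = g₀ s' → f s = f s' := fun s s' h => hinj <| by
    rw [history_comp hf.1, history_comp hf.1, hσ, ← hg, ← history_comp hg₀.1, h,
      history_comp hg₀.1]
  have hh : (f ∘ Function.surjInv hg₀.2.1) ∘ g₀ = f :=
    funext fun s => hwd _ _ (Function.surjInv_eq hg₀.2.1 (g₀ s))
  refine ⟨f ∘ Function.surjInv hg₀.2.1, ⟨hg₀.isMap_of_comp (by rw [hh]; exact hf.1.1), hh, ?_⟩, ?_⟩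
  · refine hg₀.2.1.injective_comp_right ?_
    change f₁ ∘ ((f ∘ Function.surjInv hg₀.2.1) ∘ g₀) = g₁ ∘ g₀
    rw [hh, hσ, hg]
  · rintro k ⟨-, hk, -⟩
    exact hg₀.2.1.injective_comp_right (hk.trans hh.symm)

theorem isRigidImageFactorisation_rigidImage (hσ : IsMap S A σ) :
    IsRigidImageFactorisation S A σ (rigidImage hσ)
      (Set.rangeFactorization (history S σ)) (fun c => c.1.1) := by
  refine isRigidImageFactorisation_of_injective_history (isRigidEpi_rigidImage hσ)
    (isMap_rigidImage hσ) rfl ?_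
  have key : ∀ c, history (rigidImage hσ) (fun c => c.1.1) c = c.1 := fun c => by
    obtain ⟨s, rfl⟩ := Set.rangeFactorization_surjective c
    exact history_comp (isRigidEpi_rigidImage hσ).1 _ s
  intro c d h
  rw [key, key] at h
  exact Subtype.ext h

theorem IsRigidImageFactorisation.injective_history
    (h : IsRigidImageFactorisation S A σ S₀ f f₁) : Function.Injective (history S₀ f₁) := by
  obtain ⟨hf, hf₁, rfl, huniv⟩ := h
  have hσ := hf₁.comp hf.1.1
  -- By the universal property `f` factors through the event structure of histories.
  obtain ⟨k, ⟨-, hk, -⟩, -⟩ := huniv _ _ _ _ (isRigidEpi_rigidImage hσ) (isMap_rigidImage hσ) rfl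
  intro c d hcd
  obtain ⟨s, rfl⟩ := hf.2.1 c
  obtain ⟨s', rfl⟩ := hf.2.1 d
  rw [history_comp hf.1, history_comp hf.1] at hcd
  rw [← hk]
  exact congrArg k (Subtype.ext hcd)

theorem IsRigidImageFactorisation.idempotent
    (h : IsRigidImageFactorisation S A σ S₀ f f₁) :
    IsRigidImageFactorisation S₀ A f₁ S₀ id f₁ :=
  isRigidImageFactorisation_of_injective_history (IsRigidEpi.id S₀) h.2.1 rfl h.injective_history

end RigidImage

/-! ### The rigid image of a strategy -/

section Strategy

variable {E F X : Type u} {S : PolES E} {S₀ : PolES F} {A : PolES X}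
  {σ : E → X} {f : E → F} {f₁ : F → X}

theorem IsRigidEpi.isInnocent (hf : IsRigidEpi S S₀ f) (h : IsInnocent S A (f₁ ∘ f)) :
    IsInnocent S₀ A f₁ := by
  have lift : ∀ c c', S₀.Imm c c' → ∃ s s', S.Imm s s' ∧ f s = c ∧ f s' = c' := by
    rintro c c' ⟨hne, hle, himm⟩
    obtain ⟨s', rfl⟩ := hf.2.1 c'
    obtain ⟨s, hs, rfl⟩ := hf.1.1.exists_le hle
    refine ⟨s, s', ⟨fun he => hne (congrArg f he), hs, fun d hsd hds => ?_⟩, rfl, rfl⟩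
    exact (himm (f d) (hf.1.2 _ _ hsd) (hf.1.2 _ _ hds)).imp (hf.1.1.eq_of_le hds hs)
      (hf.1.1.eq_of_le hds (S.le_refl s'))
  constructor
  · intro c c' hcc hpol
    obtain ⟨s, s', hs, rfl, rfl⟩ := lift c c' hcc
    exact h.1 s s' hs ((hf.1.1.2 s).symm.trans hpol)
  · intro c c' hcc hpol
    obtain ⟨s, s', hs, rfl, rfl⟩ := lift c c' hcc
    exact h.2 s s' hs ((hf.1.1.2 s').symm.trans hpol)

/-- Two extensions of `x` by Opponent moves agree on events with the same image, if the map is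
innocent and events are determined by their histories. -/
theorem eq_of_isInnocent (hσ : IsMap S A σ) (hinn : IsInnocent S A σ)
    (hinj : Function.Injective (history S σ)) {x z z' : Set E} {y : Set X}
    (hz : S.IsConfig z) (hz' : S.IsConfig z') (hxz : x ⊆ z) (hxz' : x ⊆ z')
    (hzy : σ '' z ⊆ y) (hneg : ∀ a ∈ y \ σ '' x, A.pol a = Polarity.neg) (c : E) :
    ∀ c', c ∈ z → c' ∈ z' → σ c = σ c' → c = c' := by
  induction c using causal_induction (S := S.toEventStructure) with
  | h c ih =>
    intro c' hc hc' he
    by_cases hcx : σ c ∈ σ '' x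
    · obtain ⟨e, hex, hec⟩ := hcx
      rw [← (hσ.1 z hz).2 (hxz hex) hc hec]
      exact (hσ.1 z' hz').2 (hxz' hex) hc' (hec.trans he)
    · have hpol := hneg _ ⟨hzy ⟨c, hc, rfl⟩, hcx⟩
      -- By innocence the immediate causes of `c` and of `c'` lie over the same moves of `A`.
      refine hinj (Prod.ext he (Set.Subset.antisymm (history_snd_subset he ?_)
        (history_snd_subset he.symm ?_)))
      · intro u huc hne
        obtain ⟨q, huq, hqc⟩ := exists_imm huc hne
        have hA := hinn.2 q c hqc ((hσ.2 c).symm.trans hpol)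
        obtain ⟨q', hq', hqe⟩ := hσ.exists_le (he ▸ hA.2.1)
        rw [ih q hqc.2.1 hqc.1 q' (hz.2 _ _ hqc.2.1 hc) (hz'.2 _ _ hq' hc') hqe.symm] at huq
        exact S.le_trans _ _ _ huq hq'
      · intro u huc hne
        obtain ⟨q', huq, hqc⟩ := exists_imm huc hne
        have hA := hinn.2 q' c' hqc ((hσ.2 c').symm.trans (he ▸ hpol))
        obtain ⟨q, hq, hqe⟩ := hσ.exists_le (he.symm ▸ hA.2.1)
        have hqne : q ≠ c := fun h => hA.1 (by rw [← hqe, h, he])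
        rw [← ih q hq hqne q' (hz.2 _ _ hq hc) (hz'.2 _ _ hqc.2.1 hc') hqe] at huq
        exact S.le_trans _ _ _ huq hq

theorem IsRigidImageFactorisation.isStrategy (h : IsRigidImageFactorisation S A σ S₀ f f₁)
    (hσ : IsStrategy A S σ) : IsStrategy A S₀ f₁ := by
  have hinj := h.injective_history
  obtain ⟨hf, hf₁, rfl, -⟩ := h
  have hinn := hf.isInnocent hσ.2.2
  refine ⟨hf₁, fun z y hz hy hzy => ?_, hinn⟩
  obtain ⟨x, hx, rfl⟩ := hf.exists_isFinConfig hz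
  rw [← Set.image_comp] at hzy
  obtain ⟨x', ⟨hx', hxx', rfl⟩, -⟩ := hσ.2.1 x y hx hy hzy
  refine ⟨f '' x', ⟨⟨(hf.1.1.1 _ hx'.1).1, hx'.2.image f⟩, Set.image_mono hxx',
    (Set.image_comp _ _ _).symm⟩, ?_⟩
  rintro w ⟨hw, hxw, hwe⟩
  rw [Set.image_comp] at hwe hzy hy
  have hfx' := (hf.1.1.1 _ hx'.1).1
  have key := eq_of_isInnocent hf₁ hinn hinj hw.1 hfx' hxw (Set.image_mono hxx') hwe.subset
    (by simpa only [Set.image_comp] using hzy.2)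
  refine Set.Subset.antisymm (fun c hc => ?_) (fun c' hc' => ?_)
  · obtain ⟨c', hc', he⟩ := hwe.subset ⟨c, hc, rfl⟩
    rwa [key c c' hc hc' he.symm]
  · obtain ⟨c, hc, he⟩ := hwe.symm.subset ⟨c', hc', rfl⟩
    rwa [← key c c' hc hc' he]

end Strategy

/-! ### Secured bijections -/

section Secured

variable {E E₀ F C : Type u} {S : PolES E} {S₀ : PolES E₀} {T : PolES F}

theorem pairLE.mem {θ : Set (E × F)} {p q : E × F} (h : pairLE S T θ p q) : p ∈ θ ∧ q ∈ θ := by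
  induction h with
  | single h => exact ⟨h.1, h.2.1⟩
  | tail _ h ih => exact ⟨ih.1, h.2.1⟩

theorem pairLE.mono {θ θ' : Set (E × F)} (hθ : θ ⊆ θ') {p q : E × F} (h : pairLE S T θ p q) :
    pairLE S T θ' p q :=
  Relation.TransGen.mono (fun _ _ h => ⟨hθ h.1, hθ h.2.1, h.2.2⟩) _ _ h

/-- A secured bijection restricts to the finitely many pairs below a given pair. -/
theorem IsSecuredBijection.exists_finite {g : E → C} {τ : F → C} {x : Set E} {y : Set F}
    (h : IsSecuredBijection S T g τ x y) {p : E × F} (hp : p ∈ pairing g τ x y) :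
    ∃ x' y', x' ⊆ x ∧ y' ⊆ y ∧ x'.Finite ∧ p.2 ∈ y' ∧ IsSecuredBijection S T g τ x' y' := by
  obtain ⟨hx, hy, himg, hanti, hfin⟩ := h
  set θ := pairing g τ x y
  set D : Set (E × F) := {q | pairLE S T θ q p}
  have hDθ : D ⊆ θ := fun q hq => (pairLE.mem hq).1
  have hpD : p ∈ D := .single ⟨hp, hp, .inl (S.le_refl _)⟩
  have hxD : Prod.fst '' D ⊆ x := by rintro _ ⟨q, hq, rfl⟩; exact (hDθ hq).1
  have hyD : Prod.snd '' D ⊆ y := by rintro _ ⟨q, hq, rfl⟩; exact (hDθ hq).2.1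
  have hsub : pairing g τ (Prod.fst '' D) (Prod.snd '' D) ⊆ θ :=
    fun q hq => ⟨hxD hq.1, hyD hq.2.1, hq.2.2⟩
  refine ⟨Prod.fst '' D, Prod.snd '' D, hxD, hyD, (hfin p).image _, ⟨p, hpD, rfl⟩, ⟨?_, ?_⟩,
    ⟨?_, ?_⟩, ?_, ?_, ?_⟩
  · exact fun X hX => hx.1 X (hX.trans hxD)
  · rintro _ a hle ⟨q, hq, rfl⟩
    have hax := hx.2 _ _ hle (hDθ hq).1
    obtain ⟨b, hb, hab⟩ := himg.subset ⟨a, hax, rfl⟩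
    exact ⟨(a, b), .head ⟨⟨hax, hb, hab.symm⟩, hDθ hq, .inl hle⟩ hq, rfl⟩
  · exact fun X hX => hy.1 X (hX.trans hyD)
  · rintro _ b hle ⟨q, hq, rfl⟩
    have hby := hy.2 _ _ hle (hDθ hq).2.1
    obtain ⟨a, ha, hab⟩ := himg.symm.subset ⟨b, hby, rfl⟩
    exact ⟨(a, b), .head ⟨⟨ha, hby, hab⟩, hDθ hq, .inr hle⟩ hq, rfl⟩
  · ext c
    constructor
    · rintro ⟨_, ⟨q, hq, rfl⟩, rfl⟩
      exact ⟨_, ⟨q, hq, rfl⟩, (hDθ hq).2.2.symm⟩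
    · rintro ⟨_, ⟨q, hq, rfl⟩, rfl⟩
      exact ⟨_, ⟨q, hq, rfl⟩, (hDθ hq).2.2⟩
  · exact fun q r hqr hrq => hanti q r (hqr.mono hsub) (hrq.mono hsub)
  · exact fun q => (hfin q).subset fun r hr => pairLE.mono hsub hr

variable {f : E → E₀} {f₁ : E₀ → C} {τ : F → C} {x : Set E} {y : Set F}

theorem pairLE_image_iff (hf : IsRigid S S₀ f) (hx : S.IsConfig x) {p q : E × F}
    (hp : p ∈ pairing (f₁ ∘ f) τ x y) (hq : q ∈ pairing (f₁ ∘ f) τ x y) :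
    pairLE S₀ T (pairing f₁ τ (f '' x) y) (Prod.map f id p) (Prod.map f id q) ↔
      pairLE S T (pairing (f₁ ∘ f) τ x y) p q := by
  have hstep : ∀ p ∈ pairing (f₁ ∘ f) τ x y, ∀ q ∈ pairing (f₁ ∘ f) τ x y,
      (S₀.le (f p.1) (f q.1) ∨ T.le p.2 q.2) → pairLE S T (pairing (f₁ ∘ f) τ x y) p q :=
    fun p hp q hq h => .single ⟨hp, hq, h.imp_left (hf.1.le_of_le hx hp.1 hq.1)⟩
  constructor
  · intro h
    generalize hq₀ : Prod.map f id q = q₀ at h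
    induction h generalizing q with
    | single h => subst hq₀; exact hstep p hp q hq h.2.2
    | tail _ h ih =>
      obtain ⟨⟨⟨a, ha, ha'⟩, hb, hab⟩, -, hle⟩ := h
      subst hq₀
      rename_i r _
      obtain ⟨r₁, r₂⟩ := r
      change f a = r₁ at ha'
      subst ha'
      exact (ih (q := (a, r₂)) ⟨ha, hb, hab⟩ rfl).trans
        (hstep (a, r₂) ⟨ha, hb, hab⟩ q hq hle)
  · refine Relation.TransGen.lift (Prod.map f id) (fun a b h => ?_) _ _
    exact ⟨⟨⟨_, h.1.1, rfl⟩, h.1.2⟩, ⟨⟨_, h.2.1.1, rfl⟩, h.2.1.2⟩, h.2.2.imp_left (hf.2 _ _)⟩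

/-- A rigid map is an order isomorphism from each configuration to its image, hence neither creates
nor destroys secured bijections. -/
theorem isSecuredBijection_image_iff (hf : IsRigid S S₀ f) (hx : S.IsConfig x) :
    IsSecuredBijection S₀ T f₁ τ (f '' x) y ↔ IsSecuredBijection S T (f₁ ∘ f) τ x y := by
  have hinj : ∀ p ∈ pairing (f₁ ∘ f) τ x y, ∀ q ∈ pairing (f₁ ∘ f) τ x y,
      Prod.map f id p = Prod.map f id q → p = q := fun p hp q hq h =>
    Prod.ext ((hf.1.1 x hx).2 hp.1 hq.1 (congrArg Prod.fst h)) (by simpa using congrArg Prod.snd h)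
  have hsurj : ∀ p₀ ∈ pairing f₁ τ (f '' x) y,
      ∃ p ∈ pairing (f₁ ∘ f) τ x y, Prod.map f id p = p₀ := by
    rintro ⟨_, b⟩ ⟨⟨a, ha, rfl⟩, hb, hab⟩
    exact ⟨(a, b), ⟨ha, hb, hab⟩, rfl⟩
  unfold IsSecuredBijection
  rw [Set.image_comp]
  refine ⟨fun ⟨_, hy, himg, hanti, hfin⟩ => ⟨hx, hy, himg, ?_, ?_⟩,
    fun ⟨_, hy, himg, hanti, hfin⟩ => ⟨(hf.1.1 x hx).1, hy, himg, ?_, ?_⟩⟩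
  · intro p q hpq hqp
    obtain ⟨hp, hq⟩ := hpq.mem
    exact hinj p hp q hq (hanti _ _ ((pairLE_image_iff hf hx hp hq).2 hpq)
      ((pairLE_image_iff hf hx hq hp).2 hqp))
  · intro p
    refine Set.Finite.of_finite_image ((hfin (Prod.map f id p)).subset ?_)
      fun q hq r hr => hinj q (pairLE.mem hq).1 r (pairLE.mem hr).1
    rintro _ ⟨q, hq, rfl⟩
    exact (pairLE_image_iff hf hx (pairLE.mem hq).1 (pairLE.mem hq).2).2 hq
  · intro p₀ q₀ hpq hqp
    obtain ⟨p, hp, rfl⟩ := hsurj p₀ hpq.mem.1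
    obtain ⟨q, hq, rfl⟩ := hsurj q₀ hpq.mem.2
    rw [hanti p q ((pairLE_image_iff hf hx hp hq).1 hpq) ((pairLE_image_iff hf hx hq hp).1 hqp)]
  · intro p₀
    by_cases hp₀ : p₀ ∈ pairing f₁ τ (f '' x) y
    · obtain ⟨p, hp, rfl⟩ := hsurj p₀ hp₀
      refine ((hfin p).image (Prod.map f id)).subset fun q₀ hq₀ => ?_
      obtain ⟨q, hq, rfl⟩ := hsurj q₀ (pairLE.mem hq₀).1
      exact ⟨q, (pairLE_image_iff hf hx hq hp).1 hq₀, rfl⟩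
    · exact Set.finite_empty.subset fun q₀ hq₀ => hp₀ (pairLE.mem hq₀).2

end Secured

/-! ### Interaction with a parallel component -/

section Par

variable {E E₀ F X Y : Type u} {S : PolES E} {S₀ : PolES E₀} {T : PolES F} {C : PolES Y}

theorem isConfig_par_iff {z : Set (E ⊕ Y)} :
    (S.par C).IsConfig z ↔ S.IsConfig (Sum.inl ⁻¹' z) ∧ C.IsConfig (Sum.inr ⁻¹' z) := by
  constructor
  · intro ⟨hcon, hdown⟩
    refine ⟨⟨fun W hW hfin => ?_, fun e e' hle he => hdown _ _ (.inl hle) he⟩,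
      ⟨fun W hW hfin => ?_, fun e e' hle he => hdown _ _ (.inr hle) he⟩⟩
    · simpa [Set.preimage_image_eq _ Sum.inl_injective] using
        (hcon (Sum.inl '' W) (Set.image_subset_iff.2 hW) (hfin.image _)).1
    · simpa [Set.preimage_image_eq _ Sum.inr_injective] using
        (hcon (Sum.inr '' W) (Set.image_subset_iff.2 hW) (hfin.image _)).2
  · rintro ⟨hl, hr⟩
    refine ⟨fun W hW hfin => ⟨hl.1 _ (Set.preimage_mono hW)
      (hfin.preimage Sum.inl_injective.injOn), hr.1 _ (Set.preimage_mono hW)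
      (hfin.preimage Sum.inr_injective.injOn)⟩, ?_⟩
    rintro _ _ (h | h) he
    · exact hl.2 _ _ h he
    · exact hr.2 _ _ h he

theorem IsRigid.par_id {f : E → E₀} (hf : IsRigid S S₀ f) (C : PolES Y) :
    IsRigid (S.par C) (S₀.par C) (Sum.map f id) := by
  refine ⟨⟨fun z hz => ⟨?_, ?_⟩, ?_⟩, ?_⟩
  · obtain ⟨hl, hr⟩ := isConfig_par_iff.1 hz
    have h₁ : Sum.inl ⁻¹' (Sum.map f id '' z) = f '' (Sum.inl ⁻¹' z) := by
      ext e; simp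
    have h₂ : Sum.inr ⁻¹' (Sum.map f id '' z) = Sum.inr ⁻¹' z := by
      ext e; simp
    rw [isConfig_par_iff, h₁, h₂]
    exact ⟨(hf.1.1 _ hl).1, hr⟩
  · obtain ⟨hl, -⟩ := isConfig_par_iff.1 hz
    rintro (a | a) ha (b | b) hb h
    · exact congrArg _ ((hf.1.1 _ hl).2 ha hb (Sum.inl.inj h))
    · cases h
    · cases h
    · exact congrArg _ (Sum.inr.inj h)
  · rintro (a | a)
    · exact hf.1.2 a
    · rfl
  · rintro _ _ (h | h)
    · exact .inl (hf.2 _ _ h)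
    · exact .inr h

theorem interactionDefined_image_iff {f : E → E₀} (hf : IsRigid S S₀ f) {σ₁ : E₀ → X}
    {τ : F → X ⊕ Y} {x : Set E} (hx : S.IsConfig x) {y : Set F} :
    InteractionDefined C S₀ σ₁ T τ (f '' x) y ↔ InteractionDefined C S (σ₁ ∘ f) T τ x y := by
  unfold InteractionDefined
  set w : Set Y := Sum.inr ⁻¹' (τ '' y)
  have himg : Sum.inl '' (f '' x) ∪ Sum.inr '' w =
      Sum.map f id '' (Sum.inl '' x ∪ Sum.inr '' w : Set (E ⊕ Y)) := by
    ext (e | e) <;> simp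
  have hcomp : Sum.map (σ₁ ∘ f) (id : Y → Y) = Sum.map σ₁ id ∘ Sum.map f id := by
    simp
  have hl : Sum.inl ⁻¹' (Sum.inl '' x ∪ Sum.inr '' w : Set (E ⊕ Y)) = x := by ext; simp
  have hr : Sum.inr ⁻¹' (Sum.inl '' x ∪ Sum.inr '' w : Set (E ⊕ Y)) = w := by ext; simp
  have hr₀ : Sum.inr ⁻¹' (Sum.inl '' (f '' x) ∪ Sum.inr '' w : Set (E₀ ⊕ Y)) = w := by
    ext; simp
  -- Either side makes the component in `C` a configuration.
  have hw : C.IsConfig w → (S.par C).IsConfig (Sum.inl '' x ∪ Sum.inr '' w) := fun hw =>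
    isConfig_par_iff.2 ⟨hl.symm ▸ hx, hr.symm ▸ hw⟩
  constructor
  · intro h
    have hwc : C.IsConfig w := hr₀ ▸ (isConfig_par_iff.1 h.1).2
    rw [himg] at h
    rw [hcomp]
    exact (isSecuredBijection_image_iff (hf.par_id C) (hw hwc)).1 h
  · intro h
    have hc := h.1
    rw [hcomp] at h
    rw [himg]
    exact (isSecuredBijection_image_iff (hf.par_id C) hc).2 h

/-- A defined interaction restricts to a finite one retaining any given event of the test. -/
theorem InteractionDefined.exists_finite {σ : E → X} {τ : F → X ⊕ Y} {x : Set E} {y : Set F}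
    (h : InteractionDefined C S σ T τ x y) {b : F} (hb : b ∈ y) :
    ∃ x' y', S.IsFinConfig x' ∧ b ∈ y' ∧ InteractionDefined C S σ T τ x' y' := by
  obtain ⟨a, ha, hab⟩ := h.2.2.1.symm.subset ⟨b, hb, rfl⟩
  obtain ⟨w, y', -, -, hfin, hby, hsec⟩ := IsSecuredBijection.exists_finite h
    (p := (a, b)) ⟨ha, hb, hab⟩
  have hw : w = Sum.inl '' (Sum.inl ⁻¹' w) ∪ Sum.inr '' (Sum.inr ⁻¹' (τ '' y')) := by
    rw [← hsec.2.2.1]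
    ext (e | e) <;> simp
  refine ⟨Sum.inl ⁻¹' w, y', ⟨(isConfig_par_iff.1 hsec.1).1,
    hfin.preimage Sum.inl_injective.injOn⟩, hby, ?_⟩
  unfold InteractionDefined
  rwa [← hw]

end Par

/-! ### Stopping strategies -/

namespace MarkedMap

variable {X : Type u} {A : PolES X} {P Q Q' : MarkedMap A} {f : P.Ev → Q.Ev} {f' : P.Ev → Q'.Ev}

theorem exists_isRigidImage (hP : IsMap P.es A P.map) :
    ∃ (Q : MarkedMap A) (f : P.Ev → Q.Ev), P.IsRigidImage Q f :=
  ⟨⟨_, rigidImage hP, fun c => c.1.1, (fun x => Set.rangeFactorization _ '' x) '' P.stops⟩, _,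
    isRigidImageFactorisation_rigidImage hP, rfl⟩

theorem IsRigidImage.isTwoCell (h : P.IsRigidImage Q f) : P.IsTwoCell Q f :=
  ⟨h.1.1.1.1, h.1.2.2.1, fun x hx => h.2 ▸ ⟨x, hx, rfl⟩⟩

theorem IsRigidImage.isRigidImageStoppingStrategy (h : P.IsRigidImage Q f)
    (hP : P.IsStoppingStrategy) : Q.IsRigidImageStoppingStrategy := by
  refine ⟨⟨h.1.isStrategy hP.1, fun z hz => ?_⟩, h.1.idempotent, by simp⟩
  rw [h.2] at hz
  obtain ⟨x, hx, rfl⟩ := hz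
  exact (h.1.1.1.1.1 x (hP.2 x hx)).1

theorem IsRigidImage.mayEquiv (h : P.IsRigidImage Q f) : P.MayEquiv Q := by
  have hf := h.1.1
  have hσ := h.1.2.2.1
  intro N F M T τ _
  constructor
  · rintro ⟨x, y, hx, hy, hdef, htick⟩
    refine ⟨f '' x, y, (hf.1.1.1 x hx).1, hy, ?_, htick⟩
    rw [interactionDefined_image_iff hf.1 hx, hσ]
    exact hdef
  · rintro ⟨z, y, -, -, hdef, b, hb, htick⟩
    obtain ⟨z', y', hz', hb', hdef'⟩ := hdef.exists_finite hb
    obtain ⟨x, hx, rfl⟩ := hf.exists_isFinConfig hz'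
    rw [interactionDefined_image_iff hf.1 hx.1, hσ] at hdef'
    exact ⟨x, y', hx.1, hdef'.2.1, hdef', b, hb', htick⟩

theorem IsRigidImage.mustEquiv (h : P.IsRigidImage Q f) (hP : ∀ x ∈ P.stops, P.es.IsConfig x) :
    P.MustEquiv Q := by
  have hf := h.1.1
  have hσ := h.1.2.2.1
  intro N F M T τ _
  have hiff : ∀ x ∈ P.stops, ∀ y,
      InteractionDefined PolES.tick Q.es Q.map (T.restrict (visible τ)) (visMap τ) (f '' x) y ↔
      InteractionDefined PolES.tick P.es P.map (T.restrict (visible τ)) (visMap τ) x y := by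
    intro x hx y
    rw [interactionDefined_image_iff hf.1 (hP x hx), hσ]
  constructor
  · intro hmust z y hz hy hdef
    rw [h.2] at hz
    obtain ⟨x, hx, rfl⟩ := hz
    exact hmust x y hx hy ((hiff x hx y).1 hdef)
  · intro hmust x y hx hy hdef
    exact hmust (f '' x) y (h.2 ▸ ⟨x, hx, rfl⟩) hy ((hiff x hx y).2 hdef)

theorem IsRigidImage.exists_isTwoCell (h : P.IsRigidImage Q f) (h' : P.IsRigidImage Q' f') :
    ∃ k : Q.Ev → Q'.Ev, Q.IsTwoCell Q' k ∧ k ∘ f = f' := by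
  obtain ⟨k, ⟨hk, hkf, hk₁⟩, -⟩ := h'.1.2.2.2 _ _ _ _ h.1.1 h.1.2.1 h.1.2.2.1
  refine ⟨k, ⟨hk, hk₁, fun z hz => ?_⟩, hkf⟩
  rw [h.2] at hz
  obtain ⟨x, hx, rfl⟩ := hz
  rw [h'.2]
  exact ⟨x, hx, by simp only [← hkf, Set.image_comp]⟩

theorem IsRigidImage.existsUnique_invertible_isTwoCell (h : P.IsRigidImage Q f)
    (h' : P.IsRigidImage Q' f') :
    ∃! k : Q.Ev → Q'.Ev, (Q.IsTwoCell Q' k ∧ k ∘ f = f') ∧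
      ∃ l : Q'.Ev → Q.Ev, Q'.IsTwoCell Q l ∧ l ∘ k = id ∧ k ∘ l = id := by
  obtain ⟨k, hk, hkf⟩ := h.exists_isTwoCell h'
  obtain ⟨l, hl, hlf⟩ := h'.exists_isTwoCell h
  refine ⟨k, ⟨⟨hk, hkf⟩, l, hl, ?_, ?_⟩, fun m hm => ?_⟩
  · refine h.1.1.2.1.injective_comp_right ?_
    change l ∘ (k ∘ f) = f
    rw [hkf, hlf]
  · refine h'.1.1.2.1.injective_comp_right ?_
    change k ∘ (l ∘ f') = f'
    rw [hlf, hkf]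
  · exact h.1.1.2.1.injective_comp_right (hm.1.2.trans hkf.symm)

end MarkedMap

end ConcurrentGames

open ConcurrentGames
theorem mainTheorem5 {X : Type u} (A : PolES X) (hA : A.IsGame)
    (P : MarkedMap A) (hP : P.IsStoppingStrategy) :
    (∃ (Q : MarkedMap A) (f : P.Ev → Q.Ev), P.IsRigidImage Q f) ∧
    (∀ (Q : MarkedMap A) (f : P.Ev → Q.Ev), P.IsRigidImage Q f →
      Q.IsRigidImageStoppingStrategy ∧ P.IsTwoCell Q f ∧
      P.MayEquiv Q ∧ P.MustEquiv Q ∧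
      ∀ (Q' : MarkedMap A) (f' : P.Ev → Q'.Ev), P.IsRigidImage Q' f' →
        ∃! h : Q.Ev → Q'.Ev, (Q.IsTwoCell Q' h ∧ h ∘ f = f') ∧
          ∃ k : Q'.Ev → Q.Ev, Q'.IsTwoCell Q k ∧ k ∘ h = id ∧ h ∘ k = id) :=
  ⟨MarkedMap.exists_isRigidImage hP.1.1, fun _ _ h =>
    ⟨h.isRigidImageStoppingStrategy hP, h.isTwoCell, h.mayEquiv, h.mustEquiv hP.2,
      fun _ _ h' => h.existsUnique_invertible_isTwoCell h'⟩⟩
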